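/- Put $f_m=\prod_{j\ge 1}(1-q^{mj})$ for integers $m\ge1$, as formal power series in $q$ with integer coefficients, and define the integers $d_2(n)$, $n\ge0$, by $$\sum_{n=0}^\infty d_2(n)q^n=\frac{f_2^2}{f_1^7}.$$ (This is the generating function of the $2$-elongated plane partition diamond numbers.) Then for all integers $n\ge0$: $$d_2(81n+44)\equiv0\pmod{81},$$ $$d_2(81n+j)\equiv0\pmod{243}\quad\text{for each } j\in\{8,35,62,71\},$$ $$d_2(243n+71)\equiv0\pmod{729}.$$ -/

import Mathlib

open scoped PowerSeries PowerSeries.WithPiTopology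

noncomputable section

namespace ElongatedDiamonds

/-- The infinite `q`-product `(a; b)_∞ = ∏_{j ≥ 0} (1 - a b ^ j)` for formal power series `a`, `b`
with integer coefficients. The infinite product is taken coefficientwise
(product topology on `ℤ⟦X⟧`, with `ℤ` discrete). -/
def qPochhammer (a b : ℤ⟦X⟧) : ℤ⟦X⟧ :=
  ∏' j : ℕ, (1 - a * b ^ j)

/-- `f_m = (q ^ m; q ^ m)_∞`, as a formal power series in `q = X`, for `m ≥ 1`. -/
def f (m : ℕ) : ℤ⟦X⟧ :=
  qPochhammer (PowerSeries.X ^ m) (PowerSeries.X ^ m)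

/-- The product defining `f m` converges for `m ≥ 1`. -/
theorem multipliable_f {m : ℕ} (hm : 1 ≤ m) :
    Multipliable fun j : ℕ =>
      (1 : ℤ⟦X⟧) - PowerSeries.X ^ m * (PowerSeries.X ^ m) ^ j := by
  have h : (fun j : ℕ => (1 : ℤ⟦X⟧) - PowerSeries.X ^ m * (PowerSeries.X ^ m) ^ j) =
      fun j : ℕ => 1 + (-(PowerSeries.X ^ (m * (j + 1)) : ℤ⟦X⟧)) := by
    funext j
    rw [← pow_mul, ← pow_add, sub_eq_add_neg, mul_add, mul_one, add_comm m]
  rw [h]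
  nontriviality ℤ
  refine PowerSeries.WithPiTopology.multipliable_one_add_of_tendsto_order_atTop_nhds_top _ ?_
  refine ENat.tendsto_nhds_top_iff_natCast_lt.mpr fun n => Filter.eventually_atTop.mpr ⟨n, ?_⟩
  intro j hj
  rw [PowerSeries.order_neg, PowerSeries.order_X_pow]
  norm_cast
  nlinarith

theorem constantCoeff_f {m : ℕ} (hm : 1 ≤ m) : PowerSeries.constantCoeff (f m) = 1 := by
  unfold f qPochhammer
  rw [(multipliable_f hm).map_tprod (PowerSeries.constantCoeff (R := ℤ))
    (PowerSeries.WithPiTopology.continuous_constantCoeff ℤ)]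
  have hm' : m ≠ 0 := by omega
  simp [hm']

/-- The generating function `f_2 ^ k / f_1 ^ (3 k + 1)` of the numbers `d_k(n)`. The series
`f_1 ^ (3 k + 1)` has constant coefficient `1`, so it is inverted in `ℤ⟦X⟧`. -/
def genSeries (k : ℕ) : ℤ⟦X⟧ :=
  f 2 ^ k * PowerSeries.invOfUnit (f 1 ^ (3 * k + 1)) 1

/-- `genSeries k` is the quotient of `f_2 ^ k` by `f_1 ^ (3 k + 1)`. -/
theorem genSeries_mul (k : ℕ) : genSeries k * f 1 ^ (3 * k + 1) = f 2 ^ k := by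
  unfold genSeries
  rw [mul_assoc, PowerSeries.invOfUnit_mul, mul_one]
  simp [constantCoeff_f le_rfl]

/-- `d_k(n)`, the coefficient of `q ^ n` in `f_2 ^ k / f_1 ^ (3 k + 1)`. -/
def d (k n : ℕ) : ℤ :=
  PowerSeries.coeff n (genSeries k)

end ElongatedDiamonds

end

noncomputable section

namespace ElongatedDiamonds

open PowerSeries Filter Topology

/-! ### Convergence of integer power series -/

/-! Write D for `genSeries 2`, x for `levelSix`, y = q x(q³) for `levelEighteen` and v = q x³ for
`hauptmodul`, so that v(q³) = y³. The triple product gives the 3-dissections of φ(-q) and ψ(q),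
which express 1 - 2y and 1 + y as quotients of the `f m`; hence D (1 - 2y)⁴ (1 + y) = x(q³) D(q⁹)
(`genSeries_two_dissection`). The norm of 1 - 2y over q ↦ ωq, with ω a primitive cube root of unity,
is 1 - 8y³, so 1 - 8v is a quotient of the `f m` too. Eliminating the products leaves
`modular_equation`, an algebraic relation between v and y.

With u = 1/(1 + v) and r = 1/(1 + y) everything becomes polynomial: u = 4r - 6r² + 3r³, r³ = u(q³)(1
- 3r + 3r²), and (1 - 2y) r = 3r - 2, a unit modulo powers of 3. So modulo 729, D is x(q³) D(q⁹)
times a polynomial in r. By the cubic for r, the i-th section modulo 3 of a polynomial in r is xⁱ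
times a polynomial in u. Section 2, a shift by q, and section 0 therefore send D to D times a
polynomial in u, and the step can be iterated.

The progression 9n - 1 yields a factor 27 (`residueNine`), and 81n - 10 a further 9
(`residueEightyOne`). The intermediate sections give the rest: 9 on 27n + 8, 3 on 81n + 44, and a
last 3 on 243n + 71. -/

theorem tendsto_iff_eventually_X_pow_dvd {ι : Type*} {l : Filter ι} {u : ι → ℤ⟦X⟧} {g : ℤ⟦X⟧} :
    Tendsto u l (𝓝 g) ↔ ∀ d : ℕ, ∀ᶠ n in l, (X : ℤ⟦X⟧) ^ d ∣ u n - g := by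
  rw [WithPiTopology.tendsto_iff_coeff_tendsto]
  simp_rw [nhds_discrete, tendsto_pure, X_pow_dvd_iff, map_sub, sub_eq_zero]
  constructor
  · intro h d
    induction d with
    | zero => simp
    | succ d ih =>
      filter_upwards [ih, h d] with n h1 h2 m hm
      rcases Nat.lt_succ_iff_lt_or_eq.mp hm with h3 | rfl
      · exact h1 m h3
      · exact h2
  · intro h d
    filter_upwards [h (d + 1)] with n hn
    exact hn d d.lt_succ_self

theorem X_pow_dvd_of_hasSum {ι : Type*} {g : ι → ℤ⟦X⟧} {s : ℤ⟦X⟧} (h : HasSum g s) {d : ℕ}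
    (hd : ∀ i, (X : ℤ⟦X⟧) ^ d ∣ g i) : (X : ℤ⟦X⟧) ^ d ∣ s := by
  rw [X_pow_dvd_iff]
  intro m hm
  have h1 := WithPiTopology.hasSum_iff_hasSum_coeff ℤ |>.mp h m
  have h2 : (fun i => coeff m (g i)) = fun _ => 0 :=
    funext fun i => X_pow_dvd_iff.mp (hd i) m hm
  rw [h2] at h1
  exact h1.unique hasSum_zero

theorem X_pow_dvd_pow {Q : ℤ⟦X⟧} (hQ : constantCoeff Q = 0) (n : ℕ) : (X : ℤ⟦X⟧) ^ n ∣ Q ^ n :=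
  pow_dvd_pow_of_dvd (X_dvd_iff.mpr hQ) n

theorem multipliable_qPochhammer (a : ℤ⟦X⟧) {Q : ℤ⟦X⟧} (hQ : constantCoeff Q = 0) :
    Multipliable fun j : ℕ => 1 - a * Q ^ j := by
  simp_rw [sub_eq_add_neg]
  refine WithPiTopology.multipliable_one_add_of_tendsto_order_atTop_nhds_top _ ?_
  refine ENat.tendsto_nhds_top_iff_natCast_lt.mpr fun n => eventually_atTop.mpr ⟨n + 1, ?_⟩
  intro j hj
  refine lt_of_lt_of_le (b := (j : ℕ∞)) (by exact_mod_cast hj) ?_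
  rw [order_neg]
  refine nat_le_order _ _ fun i hi => ?_
  exact X_pow_dvd_iff.mp ((X_pow_dvd_pow hQ j).mul_left a) i hi

theorem hasProd_qPochhammer (a : ℤ⟦X⟧) {Q : ℤ⟦X⟧} (hQ : constantCoeff Q = 0) :
    HasProd (fun j : ℕ => 1 - a * Q ^ j) (qPochhammer a Q) :=
  (multipliable_qPochhammer a hQ).hasProd

theorem tendsto_qPochhammer (a : ℤ⟦X⟧) {Q : ℤ⟦X⟧} (hQ : constantCoeff Q = 0) :
    Tendsto (fun n => ∏ j ∈ Finset.range n, (1 - a * Q ^ j)) atTop (𝓝 (qPochhammer a Q)) :=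
  (hasProd_qPochhammer a hQ).tendsto_prod_nat

/-! ### The Jacobi triple product -/

/-- The generalized triangular number `j (j + 1) / 2`. -/
def tri (j : ℤ) : ℕ := (j * (j + 1) / 2).toNat

theorem two_mul_tri (j : ℤ) : 2 * (tri j : ℤ) = j * (j + 1) := by
  have h2 : 2 ∣ j * (j + 1) := (Int.even_mul_succ_self j).two_dvd
  have h0 : 0 ≤ j * (j + 1) := by
    rcases le_or_gt 0 j with h | h
    · positivity
    · nlinarith
  unfold tri
  rw [Int.toNat_of_nonneg (Int.ediv_nonneg h0 (by norm_num)), Int.mul_ediv_cancel' h2]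

theorem natAbs_le_tri_add_one (j : ℤ) : j.natAbs ≤ tri j + 1 := by
  have h := two_mul_tri j
  zify
  rcases le_or_gt 0 j with hj | hj
  · rw [abs_of_nonneg hj]; nlinarith
  · rw [abs_of_neg hj]; nlinarith [mul_self_nonneg (2 * j + 3)]

/-- The general term of Ramanujan's theta function. -/
def thetaTerm (a b : ℤ⟦X⟧) (j : ℤ) : ℤ⟦X⟧ := a ^ tri j * b ^ tri (-j)

theorem X_pow_dvd_thetaTerm {a b : ℤ⟦X⟧} (h : constantCoeff (a * b) = 0) {d : ℕ} {j : ℤ}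
    (hj : d + 1 ≤ j.natAbs) : (X : ℤ⟦X⟧) ^ d ∣ thetaTerm a b j := by
  have h1 := natAbs_le_tri_add_one j
  have h2 := natAbs_le_tri_add_one (-j)
  rw [Int.natAbs_neg] at h2
  refine (X_pow_dvd_pow h d).trans ?_
  rw [mul_pow]
  exact mul_dvd_mul (pow_dvd_pow _ (by omega)) (pow_dvd_pow _ (by omega))

theorem summable_thetaTerm {a b : ℤ⟦X⟧} (h : constantCoeff (a * b) = 0) :
    Summable (thetaTerm a b) := by
  rw [WithPiTopology.summable_iff_summable_coeff]
  intro d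
  refine summable_of_hasFiniteSupport ((Set.finite_Icc (-(d + 1) : ℤ) (d + 1)).subset ?_)
  intro j hj
  by_contra hj'
  refine hj (X_pow_dvd_iff.mp (X_pow_dvd_thetaTerm h (d := d + 1) ?_) d d.lt_succ_self)
  simp only [Set.mem_Icc] at hj'
  omega

/-- The finite product `(Q; Q)_n`. -/
def qFactorial (Q : ℤ⟦X⟧) (n : ℕ) : ℤ⟦X⟧ := ∏ i ∈ Finset.range n, (1 - Q * Q ^ i)

/-- The reciprocal of `(Q; Q)_z`, which is zero for negative `z`. -/
def qFactorialInv (Q : ℤ⟦X⟧) (z : ℤ) : ℤ⟦X⟧ :=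
  if 0 ≤ z then invOfUnit (qFactorial Q z.toNat) 1 else 0

theorem qFactorial_mul_inv {Q : ℤ⟦X⟧} (hQ : constantCoeff Q = 0) (n : ℕ) :
    qFactorial Q n * qFactorialInv Q n = 1 := by
  rw [qFactorialInv, if_pos (by omega), Int.toNat_natCast, mul_invOfUnit]
  simp [qFactorial, map_prod, hQ]

theorem qFactorial_succ (Q : ℤ⟦X⟧) (n : ℕ) :
    qFactorial Q (n + 1) = qFactorial Q n * (1 - Q ^ (n + 1)) := by
  rw [qFactorial, Finset.prod_range_succ, ← pow_succ', qFactorial]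

theorem qFactorialInv_of_neg (Q : ℤ⟦X⟧) {z : ℤ} (hz : z < 0) : qFactorialInv Q z = 0 :=
  if_neg (by omega)

theorem qFactorialInv_sub_one {Q : ℤ⟦X⟧} (hQ : constantCoeff Q = 0) (n : ℕ) :
    qFactorialInv Q ((n : ℤ) - 1) = qFactorialInv Q n * (1 - Q ^ n) := by
  cases n with
  | zero => simp [qFactorialInv_of_neg]
  | succ n =>
    have h1 := qFactorial_mul_inv hQ n
    have h2 := qFactorial_mul_inv hQ (n + 1)
    rw [qFactorial_succ] at h2
    rw [show (((n + 1 : ℕ) : ℤ) - 1) = (n : ℤ) by push_cast; ring]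
    linear_combination (-qFactorialInv Q n) * h2 +
      qFactorialInv Q ((n + 1 : ℕ) : ℤ) * (1 - Q ^ (n + 1)) * h1

/-- The summands of the finite form of the triple product. -/
def finiteThetaTerm (a b : ℤ⟦X⟧) (m n : ℕ) (j : ℤ) : ℤ⟦X⟧ :=
  qFactorial (a * b) (m + n) * qFactorialInv (a * b) (n + j) * qFactorialInv (a * b) (m - j) *
    thetaTerm a b j

/-- This is the q-Pascal rule: with Q = ab, s = n + j and t = m + 1 - j, it comes from 1 - Q^(s+t) =
(1 - Q^t) + Q^t (1 - Q^s). -/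
theorem finiteThetaTerm_succ {a b : ℤ⟦X⟧} (h : constantCoeff (a * b) = 0) (m n : ℕ) (j : ℤ) :
    finiteThetaTerm a b (m + 1) n j =
      finiteThetaTerm a b m n j + a * (a * b) ^ m * finiteThetaTerm a b m n (j - 1) := by
  unfold finiteThetaTerm
  rcases lt_or_ge ((n : ℤ) + j) 0 with h1 | h1
  · rw [qFactorialInv_of_neg _ h1, qFactorialInv_of_neg _ (show (n : ℤ) + (j - 1) < 0 by omega)]
    ring
  rcases lt_or_ge ((m : ℤ) + 1 - j) 0 with h2 | h2
  · rw [qFactorialInv_of_neg _ (show ((m + 1 : ℕ) : ℤ) - j < 0 by omega),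
      qFactorialInv_of_neg _ (show (m : ℤ) - j < 0 by omega),
      qFactorialInv_of_neg _ (show (m : ℤ) - (j - 1) < 0 by omega)]
    ring
  obtain ⟨s, hs⟩ := Int.eq_ofNat_of_zero_le h1
  obtain ⟨t, ht⟩ := Int.eq_ofNat_of_zero_le h2
  have hst : s + t = m + n + 1 := by omega
  have hT : a * (a * b) ^ m * thetaTerm a b (j - 1) = (a * b) ^ t * thetaTerm a b j := by
    have e1 := two_mul_tri j
    have e2 := two_mul_tri (j - 1)
    have e3 := two_mul_tri (-j)
    have e4 := two_mul_tri (-(j - 1))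
    have e5 : 1 + m + tri (j - 1) = t + tri j := by zify; linarith
    have e6 : m + tri (-(j - 1)) = t + tri (-j) := by zify; linarith
    calc a * (a * b) ^ m * thetaTerm a b (j - 1)
        = a ^ (1 + m + tri (j - 1)) * b ^ (m + tri (-(j - 1))) := by
          unfold thetaTerm; ring
      _ = _ := by rw [e5, e6]; unfold thetaTerm; ring
  rw [show (n : ℤ) + (j - 1) = (s : ℤ) - 1 by omega, show (n : ℤ) + j = s by omega,
    show (m : ℤ) - j = (t : ℤ) - 1 by omega, show (m : ℤ) - (j - 1) = t by omega,
    show ((m + 1 : ℕ) : ℤ) - j = t by omega, qFactorialInv_sub_one h, qFactorialInv_sub_one h,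
    show m + 1 + n = m + n + 1 by ring, qFactorial_succ, ← hst, pow_add]
  linear_combination (-qFactorial (a * b) (m + n) * qFactorialInv (a * b) s * (1 - (a * b) ^ s) *
    qFactorialInv (a * b) t) * hT

theorem finiteThetaTerm_swap (a b : ℤ⟦X⟧) (m n : ℕ) (j : ℤ) :
    finiteThetaTerm a b m n (-j) = finiteThetaTerm b a n m j := by
  unfold finiteThetaTerm thetaTerm
  rw [mul_comm a b, add_comm m n, neg_neg, sub_neg_eq_add, ← sub_eq_add_neg]
  ring

theorem hasSum_finiteThetaTerm_succ {a b : ℤ⟦X⟧} (h : constantCoeff (a * b) = 0) {m n : ℕ}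
    {s : ℤ⟦X⟧} (hs : HasSum (finiteThetaTerm a b m n) s) :
    HasSum (finiteThetaTerm a b (m + 1) n) (s * (1 + a * (a * b) ^ m)) := by
  have h1 : HasSum (fun j => finiteThetaTerm a b m n (j - 1)) s :=
    (Equiv.subRight (1 : ℤ)).hasSum_iff.mpr hs
  have h2 := hs.add (h1.mul_left (a * (a * b) ^ m))
  rw [show s * (1 + a * (a * b) ^ m) = s + a * (a * b) ^ m * s by ring]
  exact h2.congr_fun fun j => finiteThetaTerm_succ h m n j

theorem hasSum_finiteThetaTerm {a b : ℤ⟦X⟧} (h : constantCoeff (a * b) = 0) (m n : ℕ) :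
    HasSum (finiteThetaTerm a b m n)
      ((∏ j ∈ Finset.range m, (1 + a * (a * b) ^ j)) *
        ∏ j ∈ Finset.range n, (1 + b * (a * b) ^ j)) := by
  induction m with
  | zero =>
    induction n with
    | zero =>
      have h1 : finiteThetaTerm a b 0 0 0 = 1 := by
        have h2 := qFactorial_mul_inv h 0
        simp only [qFactorial, Finset.range_zero, Finset.prod_empty, one_mul, Nat.cast_zero] at h2
        simp [finiteThetaTerm, thetaTerm, tri, qFactorial, h2]
      simp only [Finset.range_zero, Finset.prod_empty, mul_one]
      rw [← h1]
      refine hasSum_single 0 fun j hj => ?_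
      unfold finiteThetaTerm
      rcases lt_or_gt_of_ne hj with h | h
      · rw [qFactorialInv_of_neg _ (show ((0 : ℕ) : ℤ) + j < 0 by omega)]; ring
      · rw [qFactorialInv_of_neg _ (show ((0 : ℕ) : ℤ) - j < 0 by omega)]; ring
    | succ n ih =>
      -- Raising n is raising m after exchanging a with b and j with -j, so the same recurrence
      -- serves.
      have h1 : HasSum (finiteThetaTerm b a n 0) _ :=
        ((Equiv.neg ℤ).hasSum_iff.mpr ih).congr_fun fun j => (finiteThetaTerm_swap a b 0 n j).symm
      have h2 := hasSum_finiteThetaTerm_succ (by rwa [mul_comm]) h1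
      have h3 : HasSum (finiteThetaTerm a b 0 (n + 1)) _ :=
        ((Equiv.neg ℤ).hasSum_iff.mpr h2).congr_fun
          fun j => (finiteThetaTerm_swap b a (n + 1) 0 j).symm
      rw [Finset.prod_range_succ, ← mul_assoc]
      simpa only [mul_comm b a] using h3
  | succ m ih =>
    have h1 := hasSum_finiteThetaTerm_succ h ih
    rw [Finset.prod_range_succ]
    convert h1 using 1
    ring

/-- **Jacobi's triple product identity**, in Ramanujan's form. -/
theorem hasSum_thetaTerm {a b : ℤ⟦X⟧} (h : constantCoeff (a * b) = 0) :
    HasSum (thetaTerm a b)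
      (qPochhammer (-a) (a * b) * qPochhammer (-b) (a * b) * qPochhammer (a * b) (a * b)) := by
  set Q := a * b with hQ
  set e := qPochhammer Q Q with he
  have hT := (summable_thetaTerm h).hasSum
  have hlim : Tendsto (fun n => (∏ j ∈ Finset.range n, (1 + a * Q ^ j)) *
      (∏ j ∈ Finset.range n, (1 + b * Q ^ j)) * e) atTop
      (𝓝 (qPochhammer (-a) Q * qPochhammer (-b) Q * e)) := by
    have h1 := tendsto_qPochhammer (-a) h
    have h2 := tendsto_qPochhammer (-b) h
    simp only [neg_mul, sub_neg_eq_add] at h1 h2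
    exact (h1.mul h2).mul_const e
  have hlim2 : Tendsto (fun n => (∏ j ∈ Finset.range n, (1 + a * Q ^ j)) *
      (∏ j ∈ Finset.range n, (1 + b * Q ^ j)) * e) atTop (𝓝 (∑' j, thetaTerm a b j)) := by
    rw [tendsto_iff_eventually_X_pow_dvd]
    intro d
    obtain ⟨N, hN⟩ := eventually_atTop.mp
      (tendsto_iff_eventually_X_pow_dvd.mp (tendsto_qPochhammer Q h) d)
    filter_upwards [eventually_ge_atTop (N + d + 1)] with n hn
    refine X_pow_dvd_of_hasSum (((hasSum_finiteThetaTerm h n n).mul_right e).sub hT) fun j => ?_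
    -- Modulo X^d the terms with large |j| vanish; for the others n + j and n - j exceed N, so each
    -- finite product may be replaced by e and the factor in front of the theta term becomes 1.
    rcases le_or_gt (d + 1) j.natAbs with hj | hj
    · have h1 := X_pow_dvd_thetaTerm h hj
      refine dvd_sub ?_ h1
      unfold finiteThetaTerm
      exact (h1.mul_left _).mul_right _
    obtain ⟨s, hs⟩ := Int.eq_ofNat_of_zero_le (show 0 ≤ (n : ℤ) + j by omega)
    obtain ⟨t, ht⟩ := Int.eq_ofNat_of_zero_le (show 0 ≤ (n : ℤ) - j by omega)
    have h1 := qFactorial_mul_inv h s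
    have h2 := qFactorial_mul_inv h t
    obtain ⟨A, hA⟩ := hN (n + n) (by omega)
    obtain ⟨B, hB⟩ := hN s (by omega)
    obtain ⟨C, hC⟩ := hN t (by omega)
    rw [← he] at hA hB hC
    unfold finiteThetaTerm
    rw [hs, ht]
    change qFactorial Q (n + n) - e = _ at hA
    change qFactorial Q s - e = _ at hB
    change qFactorial Q t - e = _ at hC
    rw [← hQ]
    refine ⟨((A - B) * qFactorialInv Q s * (1 - X ^ d * C * qFactorialInv Q t) -
      C * qFactorialInv Q t) * thetaTerm a b j, ?_⟩
    have e1 : qFactorial Q (n + n) = qFactorial Q s + X ^ d * (A - B) := by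
      linear_combination hA - hB
    have e2 : e = qFactorial Q t - X ^ d * C := by linear_combination -hC
    have e3 : qFactorial Q (n + n) * qFactorialInv Q s =
        1 + X ^ d * (A - B) * qFactorialInv Q s := by
      rw [e1]; linear_combination h1
    have e4 : qFactorialInv Q t * e = 1 - X ^ d * C * qFactorialInv Q t := by
      rw [e2]; linear_combination h2
    linear_combination (thetaTerm a b j * (qFactorialInv Q t * e)) * e3 +
      (thetaTerm a b j * (1 + X ^ d * (A - B) * qFactorialInv Q s)) * e4
  rw [tendsto_nhds_unique hlim hlim2]
  exact hT

/-! ### Elementary product identities -/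

theorem qPochhammer_eq_one_sub_mul (a : ℤ⟦X⟧) {Q : ℤ⟦X⟧} (hQ : constantCoeff Q = 0) :
    qPochhammer a Q = (1 - a) * qPochhammer (a * Q) Q := by
  have h1 := (tendsto_qPochhammer a hQ).comp (tendsto_add_atTop_nat 1)
  have h2 := (tendsto_qPochhammer (a * Q) hQ).const_mul (1 - a)
  refine tendsto_nhds_unique h1 (h2.congr fun n => ?_)
  simp only [Function.comp_apply, Finset.prod_range_succ', pow_zero, mul_one, pow_succ']
  rw [mul_comm]
  simp only [mul_assoc]

theorem qPochhammer_mul_neg (a : ℤ⟦X⟧) {Q : ℤ⟦X⟧} (hQ : constantCoeff Q = 0) :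
    qPochhammer a Q * qPochhammer (-a) Q = qPochhammer (a ^ 2) (Q ^ 2) := by
  have h1 := (tendsto_qPochhammer a hQ).mul (tendsto_qPochhammer (-a) hQ)
  have h2 := tendsto_qPochhammer (a ^ 2) (Q := Q ^ 2) (by simp [hQ])
  refine tendsto_nhds_unique h1 (h2.congr fun n => ?_)
  rw [← Finset.prod_mul_distrib]
  exact Finset.prod_congr rfl fun j _ => by ring

theorem qPochhammer_eq_prod (a : ℤ⟦X⟧) {Q : ℤ⟦X⟧} (hQ : constantCoeff Q = 0) {k : ℕ}
    (hk : 0 < k) : qPochhammer a Q = ∏ i ∈ Finset.range k, qPochhammer (a * Q ^ i) (Q ^ k) := by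
  have h1 : Tendsto (fun n => ∏ j ∈ Finset.range (k * n), (1 - a * Q ^ j)) atTop
      (𝓝 (qPochhammer a Q)) :=
    (tendsto_qPochhammer a hQ).comp (tendsto_id.const_mul_atTop' hk)
  have h2 : Tendsto (fun n => ∏ i ∈ Finset.range k, ∏ j ∈ Finset.range n,
      (1 - a * Q ^ i * (Q ^ k) ^ j)) atTop
      (𝓝 (∏ i ∈ Finset.range k, qPochhammer (a * Q ^ i) (Q ^ k))) :=
    tendsto_finsetProd _ fun i _ =>
      tendsto_qPochhammer (a * Q ^ i) (Q := Q ^ k) (by simp [hQ, hk.ne'])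
  refine tendsto_nhds_unique h1 (h2.congr fun n => ?_)
  rw [Finset.prod_comm]
  induction n with
  | zero => simp
  | succ n ih =>
    rw [Finset.prod_range_succ, ih, Nat.mul_succ, Finset.prod_range_add]
    congr 1
    exact Finset.prod_congr rfl fun i _ => by ring

theorem constantCoeff_X_pow {m : ℕ} (hm : 0 < m) : constantCoeff ((X : ℤ⟦X⟧) ^ m) = 0 := by
  simp [hm.ne']

theorem qPochhammer_X_pow_split_two {m n : ℕ} (hn : 0 < n) (a : ℤ⟦X⟧) :
    qPochhammer (a * X ^ m) (X ^ n) =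
      qPochhammer (a * X ^ m) (X ^ (2 * n)) * qPochhammer (a * X ^ (m + n)) (X ^ (2 * n)) := by
  rw [qPochhammer_eq_prod _ (constantCoeff_X_pow hn) (k := 2) (by norm_num)]
  simp only [Finset.prod_range_succ, Finset.prod_range_zero]
  congr 2 <;> ring_nf

theorem qPochhammer_X_pow_split_three {m n : ℕ} (hn : 0 < n) (a : ℤ⟦X⟧) :
    qPochhammer (a * X ^ m) (X ^ n) =
      qPochhammer (a * X ^ m) (X ^ (3 * n)) * qPochhammer (a * X ^ (m + n)) (X ^ (3 * n)) *
        qPochhammer (a * X ^ (m + 2 * n)) (X ^ (3 * n)) := by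
  rw [qPochhammer_eq_prod _ (constantCoeff_X_pow hn) (k := 3) (by norm_num)]
  simp only [Finset.prod_range_succ, Finset.prod_range_zero]
  congr 2 <;> ring_nf

theorem f_eq_mul_f_two_mul {m : ℕ} (hm : 0 < m) :
    f m = qPochhammer (X ^ m) (X ^ (2 * m)) * f (2 * m) := by
  have h := qPochhammer_X_pow_split_two (m := m) hm 1
  simp only [one_mul, ← two_mul] at h
  exact h

theorem f_mul_qPochhammer_neg {m : ℕ} (hm : 0 < m) :
    f m * qPochhammer (-X ^ m) (X ^ m) = f (2 * m) := by
  unfold f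
  rw [qPochhammer_mul_neg _ (constantCoeff_X_pow hm)]
  congr 1 <;> ring

theorem f_ne_zero {m : ℕ} (hm : 1 ≤ m) : f m ≠ 0 := by
  intro h
  have := constantCoeff_f hm
  simp [h] at this

theorem ofNat_ne_zero (n : ℕ) [n.AtLeastTwo] : (OfNat.ofNat n : ℤ⟦X⟧) ≠ 0 := by
  intro h
  have := congrArg constantCoeff h
  rw [map_ofNat, map_zero] at this
  exact OfNat.ofNat_ne_zero n this

/-! ### Three-dissections of theta series -/

theorem hasSum_int_of_three {g : ℤ → ℤ⟦X⟧} {s₀ s₁ s₂ : ℤ⟦X⟧}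
    (h₀ : HasSum (fun j => g (3 * j)) s₀) (h₁ : HasSum (fun j => g (3 * j + 1)) s₁)
    (h₂ : HasSum (fun j => g (3 * j - 1)) s₂) : HasSum g (s₀ + s₁ + s₂) := by
  have key : ∀ (c : ℤ) (s : ℤ⟦X⟧), HasSum (fun j => g (3 * j + c)) s →
      HasSum (fun n => if 3 ∣ n - c then g n else 0) s := by
    intro c s h
    have hinj : Function.Injective fun j : ℤ => 3 * j + c := fun i j hij => by
      simp only at hij; omega
    refine (hinj.hasSum_iff ?_).mp (h.congr_fun fun j => ?_)
    · intro n hn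
      refine if_neg fun ⟨k, hk⟩ => hn ⟨k, by simp only; omega⟩
    · simp
  have H := ((key 0 s₀ (by simpa using h₀)).add (key 1 s₁ h₁)).add (key (-1) s₂ h₂)
  refine H.congr_fun fun n => ?_
  rcases (by omega : n % 3 = 0 ∨ n % 3 = 1 ∨ n % 3 = 2) with h | h | h
  · rw [if_pos (by omega), if_neg (by omega), if_neg (by omega)]; ring
  · rw [if_neg (by omega), if_pos (by omega), if_neg (by omega)]; ring
  · rw [if_neg (by omega), if_neg (by omega), if_pos (by omega)]; ring

theorem hasSum_thetaTerm_phi {m : ℕ} (hm : 0 < m) :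
    HasSum (thetaTerm (-X ^ m) (-X ^ m)) (qPochhammer (X ^ m) (X ^ (2 * m)) * f m) := by
  have h := hasSum_thetaTerm (a := -X ^ m) (b := -X ^ m) (by simp [hm.ne'])
  rw [neg_neg, show (-X ^ m * -X ^ m : ℤ⟦X⟧) = X ^ (2 * m) by ring] at h
  rw [f_eq_mul_f_two_mul hm, ← mul_assoc]
  exact h

/-- The left side is the sum of (-1)^i q^(i²) over all integers i. The classes i = 3j + 1 and i = 3j
- 1 contribute equally, whence the factor 2. -/
theorem phi_dissection :
    qPochhammer X (X ^ 2) * f 1 = qPochhammer (X ^ 9) (X ^ 18) * f 9 -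
      2 * X * (qPochhammer (X ^ 3) (X ^ 18) * qPochhammer (X ^ 15) (X ^ 18) * f 18) := by
  have h := hasSum_thetaTerm_phi one_pos
  have h₀ := hasSum_thetaTerm_phi (m := 9) (by norm_num)
  have h₁ := hasSum_thetaTerm (a := -X ^ 15) (b := -X ^ 3) (by simp)
  have h₂ := hasSum_thetaTerm (a := -X ^ 3) (b := -X ^ 15) (by simp)
  rw [neg_neg, neg_neg, show (-X ^ 15 * -X ^ 3 : ℤ⟦X⟧) = X ^ 18 by ring] at h₁
  rw [neg_neg, neg_neg, show (-X ^ 3 * -X ^ 15 : ℤ⟦X⟧) = X ^ 18 by ring] at h₂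
  have e : ∀ j i : ℤ, ∀ k l n : ℕ, Odd k → Odd l →
      tri i + tri (-i) = n + (k * tri j + l * tri (-j)) →
      thetaTerm (-X ^ 1) (-X ^ 1) i = (-X) ^ n * thetaTerm (-X ^ k) (-X ^ l) j := by
    intro j i k l n hk hl hi
    unfold thetaTerm
    rw [← hk.neg_pow, ← hl.neg_pow, pow_one, ← pow_add, hi]
    ring
  have H := hasSum_int_of_three (g := thetaTerm (-X ^ 1) (-X ^ 1))
    (h₀.congr_fun fun j => ?_) ((h₁.mul_left ((-X) ^ 1)).congr_fun fun j => ?_)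
    ((h₂.mul_left ((-X) ^ 1)).congr_fun fun j => ?_)
  · have := h.unique H
    simp only [pow_one, mul_one] at this
    rw [this]
    unfold f
    ring
  · rw [e j (3 * j) 9 9 0 (by decide) (by decide), pow_zero, one_mul]
    zify; linarith [two_mul_tri j, two_mul_tri (-j), two_mul_tri (3 * j), two_mul_tri (-(3 * j))]
  · refine e j _ 15 3 1 (by decide) (by decide) ?_
    zify
    linarith [two_mul_tri j, two_mul_tri (-j), two_mul_tri (3 * j + 1), two_mul_tri (-(3 * j + 1))]
  · refine e j _ 3 15 1 (by decide) (by decide) ?_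
    zify
    linarith [two_mul_tri j, two_mul_tri (-j), two_mul_tri (3 * j - 1), two_mul_tri (-(3 * j - 1))]

/-- Summing over all integers counts each triangular number twice; on the product side the 2 is the
factor 1 - (-1). -/
theorem hasSum_thetaTerm_psi {m : ℕ} (hm : 0 < m) :
    HasSum (thetaTerm (X ^ m) 1) (2 * (qPochhammer (-X ^ m) (X ^ m) * f (2 * m))) := by
  have h := hasSum_thetaTerm (a := X ^ m) (b := 1) (by simp [hm.ne'])
  rw [mul_one, qPochhammer_eq_one_sub_mul (-1) (constantCoeff_X_pow hm), neg_one_mul] at h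
  convert h using 1
  rw [← f_mul_qPochhammer_neg hm, f]
  ring

theorem psi_dissection :
    qPochhammer (-X) X * f 2 =
      qPochhammer (-X ^ 3) (X ^ 9) * qPochhammer (-X ^ 6) (X ^ 9) * f 9 +
      X * (qPochhammer (-X ^ 9) (X ^ 9) * f 18) := by
  have h := hasSum_thetaTerm_psi one_pos
  have h₀ := hasSum_thetaTerm (a := X ^ 6) (b := X ^ 3) (by simp)
  have h₁ := hasSum_thetaTerm_psi (m := 9) (by norm_num)
  have h₂ := hasSum_thetaTerm (a := X ^ 3) (b := X ^ 6) (by simp)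
  rw [show (X ^ 6 * X ^ 3 : ℤ⟦X⟧) = X ^ 9 by ring] at h₀
  rw [show (X ^ 3 * X ^ 6 : ℤ⟦X⟧) = X ^ 9 by ring] at h₂
  have e : ∀ j i : ℤ, ∀ k l n : ℕ, tri i = n + (k * tri j + l * tri (-j)) →
      thetaTerm (X ^ 1) 1 i = X ^ n * thetaTerm (X ^ k) (X ^ l) j := by
    intro j i k l n hi
    unfold thetaTerm
    rw [pow_one, one_pow, mul_one, hi]
    ring
  have H := hasSum_int_of_three (g := thetaTerm (X ^ 1) 1)
    (h₀.congr_fun fun j => ?_) ((h₁.mul_left (X ^ 1)).congr_fun fun j => ?_)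
    (h₂.congr_fun fun j => ?_)
  · have := h.unique H
    simp only [pow_one, mul_one] at this
    refine mul_left_cancel₀ (ofNat_ne_zero 2) ?_
    rw [this]
    unfold f
    ring
  · rw [e j (3 * j) 6 3 0, pow_zero, one_mul]
    zify; linarith [two_mul_tri j, two_mul_tri (-j), two_mul_tri (3 * j)]
  · rw [e j _ 9 0 1, pow_zero]
    zify
    linarith [two_mul_tri j, two_mul_tri (-j), two_mul_tri (3 * j + 1)]
  · rw [e j _ 3 6 0, pow_zero, one_mul]
    zify
    linarith [two_mul_tri j, two_mul_tri (-j), two_mul_tri (3 * j - 1)]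

/-! ### The level-six function -/

/-- The quotient `f_1 f_6 ^ 3 / (f_2 f_3 ^ 3)`. -/
def levelSix : ℤ⟦X⟧ := f 1 * f 6 ^ 3 * invOfUnit (f 2 * f 3 ^ 3) 1

theorem levelSix_mul : levelSix * (f 2 * f 3 ^ 3) = f 1 * f 6 ^ 3 := by
  unfold levelSix
  rw [mul_assoc, invOfUnit_mul, mul_one]
  simp [constantCoeff_f]

/-- The substitution `q ↦ q ^ 3`. -/
abbrev cubeSubst : ℤ⟦X⟧ →ₐ[ℤ] ℤ⟦X⟧ := expand 3 three_ne_zero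

theorem cubeSubst_injective : Function.Injective cubeSubst := by
  intro F G h
  ext n
  rw [← coeff_expand_mul 3 three_ne_zero F n, ← coeff_expand_mul 3 three_ne_zero G n]
  exact congrArg _ h

theorem continuous_cubeSubst : Continuous cubeSubst := by
  refine continuous_iff_continuousAt.mpr fun F => ?_
  refine (WithPiTopology.tendsto_iff_coeff_tendsto ℤ _ _ _).mpr fun d => ?_
  simp only [cubeSubst, coeff_expand]
  split_ifs
  · exact (WithPiTopology.continuous_coeff ℤ _).tendsto F
  · exact tendsto_const_nhds

theorem cubeSubst_qPochhammer (a : ℤ⟦X⟧) {Q : ℤ⟦X⟧} (hQ : constantCoeff Q = 0) :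
    cubeSubst (qPochhammer a Q) = qPochhammer (cubeSubst a) (cubeSubst Q) := by
  unfold qPochhammer
  rw [(multipliable_qPochhammer a hQ).map_tprod cubeSubst continuous_cubeSubst]
  simp

theorem cubeSubst_f {m : ℕ} (hm : 0 < m) : cubeSubst (f m) = f (3 * m) := by
  unfold f
  rw [cubeSubst_qPochhammer _ (constantCoeff_X_pow hm)]
  simp [pow_mul]

/-- The function `q x(q ^ 3)` where `x` is `levelSix`. -/
def levelEighteen : ℤ⟦X⟧ := X * cubeSubst levelSix

theorem levelEighteen_mul : levelEighteen * (f 6 * f 9 ^ 3) = X * (f 3 * f 18 ^ 3) := by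
  have h := congrArg cubeSubst levelSix_mul
  simp only [map_mul, map_pow, cubeSubst_f, Nat.ofNat_pos, zero_lt_one] at h
  norm_num at h
  unfold levelEighteen
  linear_combination X * h

theorem f_one_sq_mul_f_eighteen :
    f 1 ^ 2 * f 18 = f 2 * f 9 ^ 2 * (1 - 2 * levelEighteen) := by
  have h1 := f_eq_mul_f_two_mul (m := 1) one_pos
  have h3 := f_eq_mul_f_two_mul (m := 3) three_pos
  have h9 := f_eq_mul_f_two_mul (m := 9) (by norm_num)
  have hs := qPochhammer_X_pow_split_three (m := 3) (n := 6) (by norm_num) 1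
  norm_num at h1 h3 h9 hs
  have hy := levelEighteen_mul
  have hd := phi_dissection
  have h69 := mul_ne_zero (f_ne_zero (m := 6) (by norm_num)) (f_ne_zero (m := 9) (by norm_num))
  refine mul_left_cancel₀ h69 ?_
  have hO : qPochhammer (X ^ 3) (X ^ 18) * qPochhammer (X ^ 15) (X ^ 18) * f 18 * (f 6 * f 9) =
      f 3 * f 18 ^ 2 := by
    rw [h3, hs, h9]; ring
  generalize qPochhammer (X ^ 3) (X ^ 18) * qPochhammer (X ^ 15) (X ^ 18) * f 18 = O at *
  linear_combination (f 6 * f 9 * f 18 * f 1) * h1 + (f 6 * f 9 * f 18 * f 2) * hd -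
    (f 6 * f 9 ^ 2 * f 2) * h9 - 2 * X * f 2 * f 18 * hO + 2 * f 2 * hy

theorem f_two_sq_mul_f_three_mul_f_eighteen :
    f 2 ^ 2 * f 3 * f 18 = f 1 * f 6 * f 9 ^ 2 * (1 + levelEighteen) := by
  have h1 := f_mul_qPochhammer_neg (m := 1) one_pos
  have h3 := f_mul_qPochhammer_neg (m := 3) three_pos
  have h9 := f_mul_qPochhammer_neg (m := 9) (by norm_num)
  have hs := qPochhammer_X_pow_split_three (m := 3) (n := 3) (by norm_num) (-1)
  norm_num at h1 h3 h9 hs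
  have hy := levelEighteen_mul
  have hd := psi_dissection
  refine mul_left_cancel₀ (f_ne_zero (m := 9) (by norm_num)) ?_
  have hC : qPochhammer (-X ^ 3) (X ^ 9) * qPochhammer (-X ^ 6) (X ^ 9) * f 9 * (f 3 * f 18) =
      f 9 ^ 2 * f 6 := by
    rw [← h3, hs, ← h9]; ring
  generalize qPochhammer (-X ^ 3) (X ^ 9) * qPochhammer (-X ^ 6) (X ^ 9) * f 9 = C at *
  linear_combination (-f 9 * f 2 * f 3 * f 18) * h1 + f 9 * f 1 * f 3 * f 18 * hd +
    f 9 * f 1 * hC + X * f 1 * f 3 * f 18 ^ 2 * h9 - f 1 * hy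

/-! ### The cubic norm -/

/-- The product of the three series obtained from `F` by `q ↦ ω ^ i q`, `i = 0, 1, 2`. -/
def cubicNorm (ω : ℂ) : ℤ⟦X⟧ →* ℂ⟦X⟧ where
  toFun F := PowerSeries.map (Int.castRingHom ℂ) F *
    rescale ω (PowerSeries.map (Int.castRingHom ℂ) F) *
    rescale (ω ^ 2) (PowerSeries.map (Int.castRingHom ℂ) F)
  map_one' := by simp
  map_mul' F G := by simp only [map_mul]; ring

theorem cubicNorm_apply (ω : ℂ) (F : ℤ⟦X⟧) :
    cubicNorm ω F = PowerSeries.map (Int.castRingHom ℂ) F *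
      rescale ω (PowerSeries.map (Int.castRingHom ℂ) F) *
      rescale (ω ^ 2) (PowerSeries.map (Int.castRingHom ℂ) F) := rfl

theorem continuous_map_intCast : Continuous (PowerSeries.map (Int.castRingHom ℂ)) := by
  refine continuous_iff_continuousAt.mpr fun F => ?_
  refine (WithPiTopology.tendsto_iff_coeff_tendsto ℂ _ _ _).mpr fun d => ?_
  simp only [coeff_map]
  exact (continuous_of_discreteTopology.comp (WithPiTopology.continuous_coeff ℤ d)).tendsto F

theorem continuous_rescale (c : ℂ) : Continuous (rescale c : ℂ⟦X⟧ →+* ℂ⟦X⟧) := by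
  refine continuous_iff_continuousAt.mpr fun F => ?_
  refine (WithPiTopology.tendsto_iff_coeff_tendsto ℂ _ _ _).mpr fun d => ?_
  simp only [coeff_rescale]
  exact ((WithPiTopology.continuous_coeff ℂ d).tendsto F).const_mul _

theorem continuous_cubicNorm (ω : ℂ) : Continuous (cubicNorm ω) :=
  (continuous_map_intCast.mul ((continuous_rescale ω).comp continuous_map_intCast)).mul
    ((continuous_rescale (ω ^ 2)).comp continuous_map_intCast)

theorem rescale_map_cubeSubst {c : ℂ} (hc : c ^ 3 = 1) (F : ℤ⟦X⟧) :
    rescale c (PowerSeries.map (Int.castRingHom ℂ) (cubeSubst F)) =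
      PowerSeries.map (Int.castRingHom ℂ) (cubeSubst F) := by
  ext n
  rw [coeff_rescale, coeff_map, coeff_expand]
  split_ifs with h
  · obtain ⟨k, rfl⟩ := h
    rw [pow_mul, hc, one_pow, one_mul]
  · simp

section Norm

variable {ω : ℂ} (hω : 1 + ω + ω ^ 2 = 0)
include hω

theorem cubicNorm_cubeSubst (F : ℤ⟦X⟧) :
    cubicNorm ω (cubeSubst F) = PowerSeries.map (Int.castRingHom ℂ) (cubeSubst F ^ 3) := by
  have h3 : ω ^ 3 = 1 := by linear_combination (ω - 1) * hω
  have h6 : (ω ^ 2) ^ 3 = 1 := by rw [← pow_mul, mul_comm, pow_mul, h3, one_pow]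
  rw [cubicNorm_apply, rescale_map_cubeSubst h3, rescale_map_cubeSubst h6,
    map_pow]
  ring

theorem cubicNorm_one_sub_X_pow {m : ℕ} (hm : ¬ 3 ∣ m) :
    cubicNorm ω (1 - X ^ m) = PowerSeries.map (Int.castRingHom ℂ) (1 - X ^ (3 * m)) := by
  have h3 : ω ^ 3 = 1 := by linear_combination (ω - 1) * hω
  have hm' : 1 + ω ^ m + (ω ^ m) ^ 2 = 0 := by
    rcases (by omega : m % 3 = 1 ∨ m % 3 = 2) with h | h
    · rw [← Nat.div_add_mod m 3, h, pow_add, pow_mul, h3]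
      linear_combination hω
    · rw [← Nat.div_add_mod m 3, h, pow_add, pow_mul, h3]
      linear_combination (1 - ω + ω ^ 2) * hω
  have hC : 1 + C (ω ^ m) + C (ω ^ m) ^ 2 = (0 : ℂ⟦X⟧) := by
    rw [← map_pow, ← map_one C, ← map_add, ← map_add, hm', map_zero]
  simp only [cubicNorm_apply, map_sub, map_one, map_pow, map_X, rescale_X, mul_pow]
  rw [map_pow] at hC
  rw [pow_mul']
  linear_combination (-X ^ m + X ^ m * X ^ m * C ω ^ m - (C ω ^ m - 1) * (X ^ m) ^ 3) * hC

/-- No exponent m + 3nj is divisible by 3, so the norm replaces q by q³ in every factor. -/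
theorem cubicNorm_qPochhammer {m n : ℕ} (hm : ¬ 3 ∣ m) (hn : 0 < n) :
    cubicNorm ω (qPochhammer (X ^ m) (X ^ (3 * n))) =
      PowerSeries.map (Int.castRingHom ℂ) (cubeSubst (qPochhammer (X ^ m) (X ^ (3 * n)))) := by
  have h := hasProd_qPochhammer (X ^ m) (constantCoeff_X_pow (show 0 < 3 * n by omega))
  have h1 := h.map (cubicNorm ω) (continuous_cubicNorm ω)
  have h2 := h.map ((PowerSeries.map (Int.castRingHom ℂ)).comp (cubeSubst : ℤ⟦X⟧ →+* ℤ⟦X⟧))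
    (continuous_map_intCast.comp continuous_cubeSubst)
  refine h1.unique (h2.congr_fun fun j => ?_)
  simp only [Function.comp_apply]
  rw [← pow_mul, ← pow_add, cubicNorm_one_sub_X_pow hω (by rw [mul_assoc]; omega)]
  simp [pow_mul]

/-- The factors of `f m` whose exponent is m times a non-multiple of 3 have norm f(3m)/f(9m); the
remaining ones form f(3m), a series in q³, whose norm is its cube. -/
theorem cubicNorm_f_mul {m : ℕ} (hm : ¬ 3 ∣ m) :
    cubicNorm ω (f m) * PowerSeries.map (Int.castRingHom ℂ) (f (9 * m)) =
      PowerSeries.map (Int.castRingHom ℂ) (f (3 * m) ^ 4) := by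
  have hm0 : 0 < m := by omega
  have hs := qPochhammer_X_pow_split_three (m := m) hm0 1
  simp only [one_mul] at hs
  rw [show m + 2 * m = 3 * m by ring] at hs
  change f m = _ * f (3 * m) at hs
  have hE := congrArg cubeSubst hs
  rw [map_mul, map_mul, cubeSubst_f hm0, cubeSubst_f (by omega), ← mul_assoc] at hE
  rw [hs, map_mul, map_mul, cubicNorm_qPochhammer hω hm hm0,
    cubicNorm_qPochhammer hω (by omega) hm0, ← cubeSubst_f hm0, cubicNorm_cubeSubst hω,
    cubeSubst_f hm0, ← map_mul, ← map_mul, ← map_mul]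
  congr 1
  rw [show 3 * 3 * m = 9 * m by ring] at hE
  linear_combination (-f (3 * m) ^ 3) * hE

theorem cubicNorm_one_sub_two_mul_levelEighteen :
    cubicNorm ω (1 - 2 * levelEighteen) =
      PowerSeries.map (Int.castRingHom ℂ) (1 - 8 * levelEighteen ^ 3) := by
  have h3 : ω ^ 3 = 1 := by linear_combination (ω - 1) * hω
  have h6 : (ω ^ 2) ^ 3 = 1 := by rw [← pow_mul, mul_comm, pow_mul, h3, one_pow]
  have hC : 1 + C ω + C ω ^ 2 = (0 : ℂ⟦X⟧) := by
    rw [← map_pow, ← map_one C, ← map_add, ← map_add, hω, map_zero]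
  simp only [cubicNorm_apply, map_sub, map_one, map_pow, map_mul, map_ofNat, levelEighteen,
    map_X, rescale_X, rescale_map_cubeSubst h3, rescale_map_cubeSubst h6]
  generalize PowerSeries.map (Int.castRingHom ℂ) (cubeSubst levelSix) = Y
  linear_combination (-2 * X * Y + 4 * C ω * (X * Y) ^ 2 - 8 * (C ω - 1) * (X * Y) ^ 3) * hC

end Norm

theorem one_sub_eight_mul_levelEighteen_pow :
    f 3 ^ 8 * f 18 ^ 4 = f 6 ^ 4 * f 9 ^ 8 * (1 - 8 * levelEighteen ^ 3) := by
  obtain ⟨ω, hω⟩ : ∃ ω : ℂ, 1 + ω + ω ^ 2 = 0 := by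
    obtain ⟨ω, h⟩ := IsAlgClosed.exists_pow_nat_eq (-3 : ℂ) (two_pos)
    exact ⟨(ω - 1) / 2, by linear_combination h / 4⟩
  have hinj : Function.Injective (PowerSeries.map (Int.castRingHom ℂ)) := by
    intro F G h
    ext n
    have := congrArg (coeff n) h
    simpa using this
  apply hinj
  have h1 := cubicNorm_f_mul hω (m := 1) (by norm_num)
  have h2 := cubicNorm_f_mul hω (m := 2) (by norm_num)
  have h9 := cubicNorm_cubeSubst hω (f 3)
  have h18 := cubicNorm_cubeSubst hω (f 6)
  have hy := cubicNorm_one_sub_two_mul_levelEighteen hω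
  have h := congrArg (cubicNorm ω) f_one_sq_mul_f_eighteen
  rw [cubeSubst_f (by norm_num)] at h9 h18
  norm_num only at h1 h2 h9 h18
  rw [map_mul, map_mul, map_mul, map_pow, map_pow, h9, h18, hy] at h
  simp only [map_mul, map_pow] at h h1 h2 ⊢
  generalize PowerSeries.map (Int.castRingHom ℂ) = ι at *
  linear_combination (-(ι (f 3) ^ 4 + cubicNorm ω (f 1) * ι (f 9)) * ι (f 18) ^ 4) * h1 +
    (ι (f 9) ^ 8 * ι (1 - 8 * levelEighteen ^ 3)) * h2 + ι (f 9) ^ 2 * ι (f 18) * h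

/-! ### The modular equation -/

/-- The Hauptmodul `q f_1 ^ 3 f_6 ^ 9 / (f_2 ^ 3 f_3 ^ 9)` of level six. -/
def hauptmodul : ℤ⟦X⟧ := X * levelSix ^ 3

theorem cubeSubst_hauptmodul : cubeSubst hauptmodul = levelEighteen ^ 3 := by
  simp only [hauptmodul, levelEighteen, map_mul, map_pow, cubeSubst, expand_X]
  ring

theorem one_sub_eight_mul_hauptmodul :
    f 1 ^ 8 * f 6 ^ 4 = f 2 ^ 4 * f 3 ^ 8 * (1 - 8 * hauptmodul) := by
  apply cubeSubst_injective
  have h := one_sub_eight_mul_levelEighteen_pow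
  simp only [map_mul, map_pow, map_sub, map_one, map_ofNat, cubeSubst_hauptmodul,
    cubeSubst_f (show 0 < 1 by norm_num), cubeSubst_f (show 0 < 2 by norm_num),
    cubeSubst_f (show 0 < 3 by norm_num), cubeSubst_f (show 0 < 6 by norm_num)]
  exact h

theorem constantCoeff_levelEighteen : constantCoeff levelEighteen = 0 := by
  simp [levelEighteen]

/-- The product formulas give (1 - 8v)(1 - 8y³) = (1 - 2y)⁴. Cancelling 1 - 2y, and then 8, leaves
the relation. -/
theorem modular_equation :
    hauptmodul * (1 + 2 * levelEighteen + 4 * levelEighteen ^ 2) =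
      levelEighteen * (1 - levelEighteen + levelEighteen ^ 2) := by
  have h1 := one_sub_eight_mul_hauptmodul
  have h2 := one_sub_eight_mul_levelEighteen_pow
  have h3 := f_one_sq_mul_f_eighteen
  have hne : ∀ m : ℕ, 1 ≤ m → f m ≠ 0 := fun m hm => f_ne_zero hm
  have hy : 1 - 2 * levelEighteen ≠ 0 := by
    intro h
    have := congrArg constantCoeff h
    simp [constantCoeff_levelEighteen] at this
  have hP : f 2 ^ 4 * f 3 ^ 8 * f 6 ^ 4 * f 9 ^ 8 ≠ 0 :=
    mul_ne_zero (mul_ne_zero (mul_ne_zero (pow_ne_zero _ (hne 2 (by norm_num)))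
      (pow_ne_zero _ (hne 3 (by norm_num)))) (pow_ne_zero _ (hne 6 (by norm_num))))
      (pow_ne_zero _ (hne 9 (by norm_num)))
  refine mul_left_cancel₀ (ofNat_ne_zero 8) (mul_left_cancel₀ hy (mul_left_cancel₀ hP ?_))
  have h34 : f 1 ^ 8 * f 18 ^ 4 = f 2 ^ 4 * f 9 ^ 8 * (1 - 2 * levelEighteen) ^ 4 := by
    linear_combination (f 1 ^ 4 * f 18 ^ 2 + (f 2 * f 9 ^ 2 * (1 - 2 * levelEighteen)) ^ 2) *
      (f 1 ^ 2 * f 18 + f 2 * f 9 ^ 2 * (1 - 2 * levelEighteen)) * h3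
  linear_combination (f 6 ^ 4 * f 9 ^ 8 * (1 - 8 * levelEighteen ^ 3)) * h1 +
    f 1 ^ 8 * f 6 ^ 4 * h2 - f 3 ^ 8 * f 6 ^ 4 * h34

theorem genSeries_two_dissection :
    genSeries 2 * (1 - 2 * levelEighteen) ^ 4 * (1 + levelEighteen) =
      cubeSubst (levelSix * cubeSubst (genSeries 2)) := by
  have hne : ∀ m : ℕ, 1 ≤ m → f m ≠ 0 := fun m hm => f_ne_zero hm
  have hP : f 1 * f 2 ^ 4 * f 6 * f 9 ^ 10 ≠ 0 :=
    mul_ne_zero (mul_ne_zero (mul_ne_zero (hne 1 le_rfl) (pow_ne_zero _ (hne 2 (by norm_num))))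
      (hne 6 (by norm_num))) (pow_ne_zero _ (hne 9 (by norm_num)))
  have hD := genSeries_mul 2
  have hD9 := congrArg (fun F => cubeSubst (cubeSubst F)) hD
  have hx := congrArg cubeSubst levelSix_mul
  simp only [map_mul, map_pow, cubeSubst_f, Nat.reduceMul, Nat.reduceAdd, Nat.ofNat_pos,
    zero_lt_one] at hD hD9 hx ⊢
  have h1 := f_one_sq_mul_f_eighteen
  have h2 := f_two_sq_mul_f_three_mul_f_eighteen
  have h14 : f 1 ^ 8 * f 18 ^ 4 = f 2 ^ 4 * f 9 ^ 8 * (1 - 2 * levelEighteen) ^ 4 := by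
    linear_combination (f 1 ^ 4 * f 18 ^ 2 + (f 2 * f 9 ^ 2 * (1 - 2 * levelEighteen)) ^ 2) *
      (f 1 ^ 2 * f 18 + f 2 * f 9 ^ 2 * (1 - 2 * levelEighteen)) * h1
  refine mul_left_cancel₀ hP ?_
  generalize genSeries 2 = D at *
  linear_combination (-D * f 1 * f 6 * f 9 ^ 2 * (1 + levelEighteen)) * h14 -
    D * f 1 ^ 8 * f 18 ^ 4 * h2 + f 1 * f 2 ^ 2 * f 3 * f 18 ^ 5 * hD -
    f 1 * f 2 ^ 4 * f 9 ^ 7 * cubeSubst (cubeSubst D) * hx - f 1 * f 2 ^ 4 * f 3 * f 18 ^ 3 * hD9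

/-! ### Sections of power series modulo three -/

/-- The series `∑ c(3 n + i) q ^ n` extracted from `∑ c(n) q ^ n`. -/
def sectionThree (i : ℕ) : ℤ⟦X⟧ →+ ℤ⟦X⟧ where
  toFun F := PowerSeries.mk fun n => coeff (3 * n + i) F
  map_zero' := by ext n; simp
  map_add' F G := by ext n; simp

theorem coeff_sectionThree (i n : ℕ) (F : ℤ⟦X⟧) :
    coeff n (sectionThree i F) = coeff (3 * n + i) F :=
  coeff_mk n fun n => coeff (3 * n + i) F

theorem sectionThree_cubeSubst_mul {i : ℕ} (hi : i < 3) (P F : ℤ⟦X⟧) :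
    sectionThree i (cubeSubst P * F) = P * sectionThree i F := by
  ext n
  rw [coeff_sectionThree, coeff_mul, coeff_mul]
  symm
  refine Finset.sum_of_injOn (fun p => (3 * p.1, 3 * p.2 + i)) ?_ ?_ ?_ ?_
  · intro p _ q _ h
    simp only [Prod.mk.injEq] at h
    exact Prod.ext (by omega) (by omega)
  · intro p hp
    simp only [Finset.mem_coe, Finset.HasAntidiagonal.mem_antidiagonal] at hp ⊢
    omega
  · intro p hp hp'
    rw [coeff_expand, if_neg, zero_mul]
    rintro ⟨k, hk⟩
    rw [Finset.HasAntidiagonal.mem_antidiagonal] at hp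
    refine hp' ⟨(k, n - k), ?_, Prod.ext (by simp only; omega) (by simp only; omega)⟩
    rw [Finset.mem_coe, Finset.HasAntidiagonal.mem_antidiagonal]
    simp only
    omega
  · intro p _
    rw [coeff_expand_mul, coeff_sectionThree]

theorem sectionThree_ofNat_mul {i : ℕ} (hi : i < 3) (n : ℕ) [n.AtLeastTwo] (F : ℤ⟦X⟧) :
    sectionThree i (OfNat.ofNat n * F) = OfNat.ofNat n * sectionThree i F := by
  rw [← sectionThree_cubeSubst_mul hi, map_ofNat]

theorem sectionThree_X_pow_mul_cubeSubst {i j : ℕ} (hi : i < 3) (hj : j < 3) (P : ℤ⟦X⟧) :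
    sectionThree i (X ^ j * cubeSubst P) = if i = j then P else 0 := by
  rw [mul_comm, sectionThree_cubeSubst_mul hi]
  have h : sectionThree i (X ^ j) = if i = j then 1 else 0 := by
    ext n
    rw [coeff_sectionThree, coeff_X_pow]
    split_ifs with h1 h2 h2
    · rw [show n = 0 by omega]; simp
    · omega
    · rw [coeff_one, if_neg (by omega)]
    · simp
  rw [h, mul_ite, mul_one, mul_zero]

theorem ofNat_dvd_sectionThree_sub {i : ℕ} (hi : i < 3) {n : ℕ} [n.AtLeastTwo] {F G K : ℤ⟦X⟧}
    (h : (OfNat.ofNat n : ℤ⟦X⟧) ∣ F - cubeSubst K * G) :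
    (OfNat.ofNat n : ℤ⟦X⟧) ∣ sectionThree i F - K * sectionThree i G := by
  obtain ⟨S, hS⟩ := h
  refine ⟨sectionThree i S, ?_⟩
  rw [← sectionThree_ofNat_mul hi, ← hS, map_sub, sectionThree_cubeSubst_mul hi]

/-! ### Sections of powers of the uniformizer -/

/-- The reciprocal of `1 + v`, where `v` is `hauptmodul`. -/
def uSix : ℤ⟦X⟧ := invOfUnit (1 + hauptmodul) 1

theorem uSix_mul : uSix * (1 + hauptmodul) = 1 := by
  rw [uSix, invOfUnit_mul]
  simp [hauptmodul]

/-- The reciprocal of `1 + y`, where `y` is `levelEighteen`. -/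
def uEighteen : ℤ⟦X⟧ := (1 - levelEighteen + levelEighteen ^ 2) * cubeSubst uSix

theorem cubeSubst_uSix_mul : cubeSubst uSix * (1 + levelEighteen ^ 3) = 1 := by
  have h := congrArg cubeSubst uSix_mul
  rwa [map_mul, map_add, map_one, cubeSubst_hauptmodul] at h

theorem uEighteen_mul : uEighteen * (1 + levelEighteen) = 1 := by
  rw [uEighteen]
  linear_combination cubeSubst_uSix_mul

theorem uEighteen_pow_three :
    uEighteen ^ 3 = cubeSubst uSix * (1 - 3 * uEighteen + 3 * uEighteen ^ 2) := by
  have h1 := cubeSubst_uSix_mul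
  have h2 : levelEighteen * uEighteen = 1 - uEighteen := by linear_combination uEighteen_mul
  have h3 : uEighteen ^ 3 * (1 + levelEighteen ^ 3) = 1 - 3 * uEighteen + 3 * uEighteen ^ 2 := by
    calc uEighteen ^ 3 * (1 + levelEighteen ^ 3)
        = uEighteen ^ 3 + (levelEighteen * uEighteen) ^ 3 := by ring
      _ = _ := by rw [h2]; ring
  linear_combination (-uEighteen ^ 3) * h1 + cubeSubst uSix * h3

theorem uSix_eq : uSix = 4 * uEighteen - 6 * uEighteen ^ 2 + 3 * uEighteen ^ 3 := by
  have h2 : levelEighteen * uEighteen = 1 - uEighteen := by linear_combination uEighteen_mul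
  have h3 : (1 + hauptmodul) * (1 + 2 * levelEighteen + 4 * levelEighteen ^ 2) =
      (1 + levelEighteen) ^ 3 := by linear_combination modular_equation
  have h4 : ((1 + levelEighteen) * uEighteen) ^ 3 = 1 := by
    rw [mul_comm, uEighteen_mul, one_pow]
  calc uSix = uSix * ((1 + levelEighteen) * uEighteen) ^ 3 := by rw [h4, mul_one]
    _ = (uSix * (1 + hauptmodul)) * (uEighteen ^ 3 + 2 * uEighteen ^ 2 * (levelEighteen * uEighteen)
        + 4 * uEighteen * (levelEighteen * uEighteen) ^ 2) := by
      rw [mul_pow, ← h3]; ring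
    _ = _ := by rw [uSix_mul, h2]; ring

/-- The cubic for `uEighteen` has coefficients in q³, which pass through sections; all sections of
powers thus follow from the exponents 0, 1, 2. -/
theorem sectionThree_uEighteen_pow_add_three {i : ℕ} (hi : i < 3) (k : ℕ) :
    sectionThree i (uEighteen ^ (k + 3)) = uSix * (sectionThree i (uEighteen ^ k) -
      3 * sectionThree i (uEighteen ^ (k + 1)) + 3 * sectionThree i (uEighteen ^ (k + 2))) := by
  have h : uEighteen ^ (k + 3) = cubeSubst uSix * (uEighteen ^ k - 3 * uEighteen ^ (k + 1) +
      3 * uEighteen ^ (k + 2)) := by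
    rw [pow_add, uEighteen_pow_three]; ring
  rw [h, sectionThree_cubeSubst_mul hi, map_add, map_sub, sectionThree_ofNat_mul hi,
    sectionThree_ofNat_mul hi]

theorem uEighteen_eq :
    uEighteen = X ^ 0 * cubeSubst uSix - X ^ 1 * cubeSubst (levelSix * uSix) +
      X ^ 2 * cubeSubst (levelSix ^ 2 * uSix) := by
  simp only [uEighteen, levelEighteen, map_mul, map_pow]
  ring

theorem uEighteen_sq_eq :
    uEighteen ^ 2 = X ^ 0 * cubeSubst (3 * uSix ^ 2 - 2 * uSix) +
      X ^ 1 * cubeSubst (levelSix * (uSix - 3 * uSix ^ 2)) +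
      X ^ 2 * cubeSubst (levelSix ^ 2 * (3 * uSix ^ 2)) := by
  have h := cubeSubst_uSix_mul
  simp only [uEighteen, levelEighteen, map_mul, map_pow, map_sub, map_ofNat] at h ⊢
  linear_combination (cubeSubst uSix * (X * cubeSubst levelSix - 2)) * h

theorem sectionThree_uEighteen_pow_zero {i : ℕ} (hi : i < 3) :
    sectionThree i (uEighteen ^ 0) = if i = 0 then 1 else 0 := by
  have h := sectionThree_X_pow_mul_cubeSubst hi three_pos 1
  rwa [map_one, mul_one] at h

theorem sectionThree_uEighteen_pow_one {i : ℕ} (hi : i < 3) :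
    sectionThree i (uEighteen ^ 1) = (if i = 0 then uSix else 0) -
      (if i = 1 then levelSix * uSix else 0) + (if i = 2 then levelSix ^ 2 * uSix else 0) := by
  rw [pow_one, uEighteen_eq, map_add, map_sub]
  simp only [sectionThree_X_pow_mul_cubeSubst hi, Nat.ofNat_pos, Nat.one_lt_ofNat,
    Nat.lt_add_one]

theorem sectionThree_uEighteen_pow_two {i : ℕ} (hi : i < 3) :
    sectionThree i (uEighteen ^ 2) = (if i = 0 then 3 * uSix ^ 2 - 2 * uSix else 0) +
      (if i = 1 then levelSix * (uSix - 3 * uSix ^ 2) else 0) +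
      (if i = 2 then levelSix ^ 2 * (3 * uSix ^ 2) else 0) := by
  rw [uEighteen_sq_eq, map_add, map_add]
  simp only [sectionThree_X_pow_mul_cubeSubst hi, Nat.ofNat_pos, Nat.one_lt_ofNat,
    Nat.lt_add_one]

theorem sectionThree_zero_uEighteen_pow :
    sectionThree 0 (uEighteen ^ 0) = 1 ∧ sectionThree 0 (uEighteen ^ 1) = uSix ∧
      sectionThree 0 (uEighteen ^ 2) = 3 * uSix ^ 2 - 2 * uSix := by
  rw [sectionThree_uEighteen_pow_zero three_pos, sectionThree_uEighteen_pow_one three_pos,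
    sectionThree_uEighteen_pow_two three_pos]
  simp

theorem sectionThree_one_uEighteen_pow :
    sectionThree 1 (uEighteen ^ 0) = 0 ∧ sectionThree 1 (uEighteen ^ 1) = -(levelSix * uSix) ∧
      sectionThree 1 (uEighteen ^ 2) = levelSix * (uSix - 3 * uSix ^ 2) := by
  have h : 1 < 3 := by norm_num
  rw [sectionThree_uEighteen_pow_zero h, sectionThree_uEighteen_pow_one h,
    sectionThree_uEighteen_pow_two h]
  simp

theorem sectionThree_two_uEighteen_pow :
    sectionThree 2 (uEighteen ^ 0) = 0 ∧ sectionThree 2 (uEighteen ^ 1) = levelSix ^ 2 * uSix ∧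
      sectionThree 2 (uEighteen ^ 2) = levelSix ^ 2 * (3 * uSix ^ 2) := by
  have h : 2 < 3 := by norm_num
  rw [sectionThree_uEighteen_pow_zero h, sectionThree_uEighteen_pow_one h,
    sectionThree_uEighteen_pow_two h]
  simp

/-! ### The generating function modulo powers of three -/

/-- Section 2 brings out x² and the prefactor supplies another x; the extra X completes X x³ = v,
and v u = 1 - u removes x altogether. -/
theorem ofNat_dvd_X_mul_sectionThree_two {n : ℕ} [n.AtLeastTwo] {D F G p q : ℤ⟦X⟧}
    (h : (OfNat.ofNat n : ℤ⟦X⟧) ∣ F - cubeSubst (levelSix * cubeSubst D) * G)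
    (hG : (OfNat.ofNat n : ℤ⟦X⟧) ∣ sectionThree 2 G - levelSix ^ 2 * uSix * p)
    (hp : (OfNat.ofNat n : ℤ⟦X⟧) ∣ (1 - uSix) * p - q) :
    (OfNat.ofNat n : ℤ⟦X⟧) ∣ X * sectionThree 2 F - cubeSubst D * q := by
  have h1 := dvd_add ((ofNat_dvd_sectionThree_sub (i := 2) (by norm_num) h).mul_left X)
    (hG.mul_left (X * (levelSix * cubeSubst D)))
  have h2 : hauptmodul * uSix = 1 - uSix := by linear_combination uSix_mul
  rw [hauptmodul] at h2
  have h3 := dvd_add h1 (hp.mul_left (cubeSubst D))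
  convert h3 using 1
  linear_combination (cubeSubst D * p) * h2

theorem ofNat_dvd_sectionThree_sub_mul {i : ℕ} (hi : i < 3) {n : ℕ} [n.AtLeastTwo]
    {F G K p : ℤ⟦X⟧} (h : (OfNat.ofNat n : ℤ⟦X⟧) ∣ F - cubeSubst K * G)
    (hG : (OfNat.ofNat n : ℤ⟦X⟧) ∣ sectionThree i G - p) :
    (OfNat.ofNat n : ℤ⟦X⟧) ∣ sectionThree i F - K * p := by
  have h1 := dvd_add (ofNat_dvd_sectionThree_sub hi h) (hG.mul_left K)
  convert h1 using 1
  ring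

/-- The inverse of `(3 r - 2) ^ 4` modulo `729`. -/
def invFactor (r : ℤ⟦X⟧) : ℤ⟦X⟧ :=
  319 - 273 * r + 252 * r ^ 2 + 27 * r ^ 3 + 162 * r ^ 4 + 243 * r ^ 5

theorem genSeries_two_sub_dvd :
    (729 : ℤ⟦X⟧) ∣ genSeries 2 - cubeSubst (levelSix * cubeSubst (genSeries 2)) *
      (uEighteen ^ 5 * invFactor uEighteen) := by
  have h1 := genSeries_two_dissection
  have h2 := uEighteen_mul
  have h3 : (1 - 2 * levelEighteen) * uEighteen = 3 * uEighteen - 2 := by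
    linear_combination (-2) * h2
  have h4 : genSeries 2 * (3 * uEighteen - 2) ^ 4 =
      cubeSubst (levelSix * cubeSubst (genSeries 2)) * uEighteen ^ 5 := by
    rw [← h1, ← h3]
    linear_combination
      (-genSeries 2 * ((1 - 2 * levelEighteen) * uEighteen) ^ 4) * h2
  generalize uEighteen = r at *
  -- The bracket is ((3r - 2)⁴ `invFactor` r - 1) / 729.
  refine ⟨-genSeries 2 * (7 - 48 * r + 136 * r ^ 2 - 208 * r ^ 3 + 191 * r ^ 4 - 113 * r ^ 5 +
    36 * r ^ 6 + 27 * r ^ 7 - 54 * r ^ 8 + 27 * r ^ 9), ?_⟩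
  unfold invFactor
  linear_combination (319 - 273 * r + 252 * r ^ 2 + 27 * r ^ 3 + 162 * r ^ 4 + 243 * r ^ 5) * h4

theorem dvd_X_mul_sectionThree_two_genSeries_two :
    (729 : ℤ⟦X⟧) ∣ X * sectionThree 2 (genSeries 2) - cubeSubst (genSeries 2) *
      (-363 * uEighteen ^ 2 + 192 * uEighteen ^ 3 - 180 * uEighteen ^ 4 - 351 * uEighteen ^ 5 +
        54 * uEighteen ^ 6 - 162 * uEighteen ^ 7 + 243 * uEighteen ^ 8 - 162 * uEighteen ^ 9) := by
  refine ofNat_dvd_X_mul_sectionThree_two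
    (p := 114 * uSix ^ 2 - 162 * uSix ^ 3 + 81 * uSix ^ 4) genSeries_two_sub_dvd ?_ ?_
  · rw [show uEighteen ^ 5 * invFactor uEighteen = 319 * uEighteen ^ 5 - 273 * uEighteen ^ 6 +
      252 * uEighteen ^ 7 + 27 * uEighteen ^ 8 + 162 * uEighteen ^ 9 + 243 * uEighteen ^ 10 by
      unfold invFactor; ring]
    -- The recurrence turns the section into an explicit polynomial in `uSix`; the witness is the
    -- quotient of the difference by 729. The later section witnesses arise likewise.
    refine ⟨levelSix ^ 2 * (9 * uSix ^ 3 - 104 * uSix ^ 4 + 368 * uSix ^ 5 - uSix ^ 6 -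
      4446 * uSix ^ 7 + 13689 * uSix ^ 8 - 16038 * uSix ^ 9 + 6561 * uSix ^ 10), ?_⟩
    obtain ⟨h0, h1, h2⟩ := sectionThree_two_uEighteen_pow
    simp only [map_add, map_sub, sectionThree_ofNat_mul (show 2 < 3 by norm_num), h0, h1,
      h2, sectionThree_uEighteen_pow_add_three (show 2 < 3 by norm_num), Nat.reduceAdd]
    ring
  · refine ⟨3 * uEighteen ^ 2 - 32 * uEighteen ^ 3 + 204 * uEighteen ^ 4 - 849 * uEighteen ^ 5 +
      2508 * uEighteen ^ 6 - 5454 * uEighteen ^ 7 + 8909 * uEighteen ^ 8 - 11018 * uEighteen ^ 9 +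
      10296 * uEighteen ^ 10 - 7176 * uEighteen ^ 11 + 3627 * uEighteen ^ 12 -
      1260 * uEighteen ^ 13 + 270 * uEighteen ^ 14 - 27 * uEighteen ^ 15, ?_⟩
    rw [uSix_eq]
    ring

/-- A series whose multiple by `27` has coefficients congruent to `d 2 (9 n - 1)` modulo `729`. -/
def residueNine : ℤ⟦X⟧ :=
  genSeries 2 * (7 * uSix + 4 * uSix ^ 2 + 7 * uSix ^ 3 + 9 * uSix ^ 4)

/-- Modulo 729 all coefficients of the resulting polynomial in `uSix` are multiples of 27. -/
theorem dvd_sectionThree_zero_sub_residueNine :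
    (729 : ℤ⟦X⟧) ∣ sectionThree 0 (X * sectionThree 2 (genSeries 2)) - 27 * residueNine := by
  have h := ofNat_dvd_sectionThree_sub_mul three_pos dvd_X_mul_sectionThree_two_genSeries_two
    (p := 27 * (7 * uSix + 4 * uSix ^ 2 + 7 * uSix ^ 3 + 9 * uSix ^ 4)) ?_
  · rwa [mul_left_comm] at h
  · refine ⟨uSix - 4 * uSix ^ 2 - 31 * uSix ^ 3 + 302 * uSix ^ 4 - 1611 * uSix ^ 5 +
      4662 * uSix ^ 6 - 6966 * uSix ^ 7 + 5103 * uSix ^ 8 - 1458 * uSix ^ 9, ?_⟩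
    simp only [neg_mul]
    obtain ⟨h0, h1, h2⟩ := sectionThree_zero_uEighteen_pow
    simp only [map_add, map_sub, map_neg, sectionThree_ofNat_mul (show 0 < 3 by norm_num), h0, h1,
      h2, sectionThree_uEighteen_pow_add_three (show 0 < 3 by norm_num), Nat.reduceAdd]
    ring

theorem residueNine_sub_dvd :
    (27 : ℤ⟦X⟧) ∣ residueNine - cubeSubst (levelSix * cubeSubst (genSeries 2)) *
      (-5 * uEighteen ^ 6 - 5 * uEighteen ^ 7 - 11 * uEighteen ^ 8 - 6 * uEighteen ^ 9 -
        9 * uEighteen ^ 10 + 9 * uEighteen ^ 11) := by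
  obtain ⟨S, hS⟩ := genSeries_two_sub_dvd
  rw [sub_eq_iff_eq_add] at hS
  set K := cubeSubst (levelSix * cubeSubst (genSeries 2))
  rw [residueNine, hS, uSix_eq]
  set r := uEighteen
  -- The polynomial in `uSix` is first rewritten in r and reduced modulo 27, to keep the final
  -- expansion small.
  have h : ∃ q, 7 * (4 * r - 6 * r ^ 2 + 3 * r ^ 3) + 4 * (4 * r - 6 * r ^ 2 + 3 * r ^ 3) ^ 2 +
      7 * (4 * r - 6 * r ^ 2 + 3 * r ^ 3) ^ 3 + 9 * (4 * r - 6 * r ^ 2 + 3 * r ^ 3) ^ 4 =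
      r - 5 * r ^ 2 + 7 * r ^ 3 - 12 * r ^ 4 + 9 * r ^ 6 + 27 * q :=
    ⟨r + r ^ 2 + 10 * r ^ 3 + 20 * r ^ 4 - 368 * r ^ 5 + 1241 * r ^ 6 - 2192 * r ^ 7 +
      2406 * r ^ 8 - 1721 * r ^ 9 + 792 * r ^ 10 - 216 * r ^ 11 + 27 * r ^ 12, by ring⟩
  obtain ⟨q, hq⟩ := h
  rw [hq]
  refine ⟨27 * S * (r - 5 * r ^ 2 + 7 * r ^ 3 - 12 * r ^ 4 + 9 * r ^ 6 + 27 * q) +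
    K * r ^ 5 * invFactor r * q + K * (12 * r ^ 6 - 69 * r ^ 7 + 143 * r ^ 8 - 258 * r ^ 9 +
      188 * r ^ 10 - 20 * r ^ 11 - 106 * r ^ 12 + 75 * r ^ 13 - 99 * r ^ 14 + 54 * r ^ 15 +
      81 * r ^ 16), ?_⟩
  unfold invFactor
  ring

theorem dvd_sectionThree_one_residueNine : (9 : ℤ⟦X⟧) ∣ sectionThree 1 residueNine := by
  have h := ofNat_dvd_sectionThree_sub_mul (i := 1) (p := 0) (n := 9) (by norm_num)
    ((show (9 : ℤ⟦X⟧) ∣ 27 from ⟨3, by norm_num⟩).trans residueNine_sub_dvd) ?_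
  · rwa [mul_zero, sub_zero] at h
  · refine ⟨levelSix * (-9 * uSix ^ 3 + 124 * uSix ^ 4 - 1452 * uSix ^ 5 + 14238 * uSix ^ 6 -
      77517 * uSix ^ 7 + 215541 * uSix ^ 8 - 308367 * uSix ^ 9 + 216513 * uSix ^ 10 -
      59049 * uSix ^ 11), ?_⟩
    simp only [neg_mul]
    obtain ⟨h0, h1, h2⟩ := sectionThree_one_uEighteen_pow
    simp only [map_add, map_sub, map_neg, sectionThree_ofNat_mul (show 1 < 3 by norm_num), h0, h1,
      h2, sectionThree_uEighteen_pow_add_three (show 1 < 3 by norm_num), Nat.reduceAdd]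
    ring

theorem dvd_X_mul_sectionThree_two_residueNine :
    (27 : ℤ⟦X⟧) ∣ X * sectionThree 2 residueNine - cubeSubst (genSeries 2) *
      (-5 * uEighteen ^ 2 + 8 * uEighteen ^ 3 + 6 * uEighteen ^ 4 + 9 * uEighteen ^ 5 +
        9 * uEighteen ^ 6) := by
  refine ofNat_dvd_X_mul_sectionThree_two (p := -2 * uSix ^ 2) residueNine_sub_dvd ?_ ?_
  · refine ⟨levelSix ^ 2 * (uSix ^ 3 - 18 * uSix ^ 4 + 206 * uSix ^ 5 - 2271 * uSix ^ 6 +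
      15093 * uSix ^ 7 - 50220 * uSix ^ 8 + 83106 * uSix ^ 9 - 65610 * uSix ^ 10 +
      19683 * uSix ^ 11), ?_⟩
    simp only [neg_mul]
    obtain ⟨h0, h1, h2⟩ := sectionThree_two_uEighteen_pow
    simp only [map_add, map_sub, map_neg, sectionThree_ofNat_mul (show 2 < 3 by norm_num), h0, h1,
      h2, sectionThree_uEighteen_pow_add_three (show 2 < 3 by norm_num), Nat.reduceAdd]
    ring
  · refine ⟨-uEighteen ^ 2 + 8 * uEighteen ^ 3 - 26 * uEighteen ^ 4 + 45 * uEighteen ^ 5 -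
      49 * uEighteen ^ 6 + 32 * uEighteen ^ 7 - 12 * uEighteen ^ 8 + 2 * uEighteen ^ 9, ?_⟩
    rw [uSix_eq]
    ring

/-- Modulo 3 the polynomial in r is r² + 2r³, and r³ ≡ u(q³); section 2 of r² carries a factor 3,
and that of u(q³) is zero. -/
theorem dvd_sectionThree_two_X_mul_residueNine :
    (3 : ℤ⟦X⟧) ∣ sectionThree 2 (X * sectionThree 2 residueNine) := by
  have h := ofNat_dvd_sectionThree_sub_mul (i := 2) (p := 0) (n := 3) (by norm_num)
    ((show (3 : ℤ⟦X⟧) ∣ 27 from ⟨9, by norm_num⟩).trans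
      dvd_X_mul_sectionThree_two_residueNine) ?_
  · rwa [mul_zero, sub_zero] at h
  · refine ⟨levelSix ^ 2 * (-11 * uSix ^ 2 + 15 * uSix ^ 3 + 135 * uSix ^ 4 - 729 * uSix ^ 5 +
      729 * uSix ^ 6), ?_⟩
    simp only [neg_mul]
    obtain ⟨h0, h1, h2⟩ := sectionThree_two_uEighteen_pow
    simp only [map_add, map_neg, sectionThree_ofNat_mul (show 2 < 3 by norm_num), h0, h1,
      h2, sectionThree_uEighteen_pow_add_three (show 2 < 3 by norm_num), Nat.reduceAdd]
    ring

/-- A series whose multiple by `243` has coefficients congruent to `d 2 (81 n - 10)`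
modulo `729`. -/
def residueEightyOne : ℤ⟦X⟧ := genSeries 2 * (-uSix - uSix ^ 2 - uSix ^ 3)

theorem dvd_sectionThree_zero_sub_residueEightyOne :
    (27 : ℤ⟦X⟧) ∣ sectionThree 0 (X * sectionThree 2 residueNine) - 9 * residueEightyOne := by
  have h := ofNat_dvd_sectionThree_sub_mul three_pos dvd_X_mul_sectionThree_two_residueNine
    (p := 9 * (-uSix - uSix ^ 2 - uSix ^ 3)) ?_
  · rwa [mul_left_comm] at h
  · refine ⟨uSix - 2 * uSix ^ 2 - 3 * uSix ^ 3 + 60 * uSix ^ 4 - 135 * uSix ^ 5 + 81 * uSix ^ 6,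
      ?_⟩
    simp only [neg_mul]
    obtain ⟨h0, h1, h2⟩ := sectionThree_zero_uEighteen_pow
    simp only [map_add, map_neg, sectionThree_ofNat_mul (show 0 < 3 by norm_num), h0, h1,
      h2, sectionThree_uEighteen_pow_add_three (show 0 < 3 by norm_num), Nat.reduceAdd]
    ring

/-- Modulo 3 one has u ≡ r and `invFactor` r ≡ 1. -/
theorem residueEightyOne_sub_dvd :
    (3 : ℤ⟦X⟧) ∣ residueEightyOne - cubeSubst (levelSix * cubeSubst (genSeries 2)) *
      (-uEighteen ^ 6 - uEighteen ^ 7 - uEighteen ^ 8) := by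
  obtain ⟨S, hS⟩ := genSeries_two_sub_dvd
  rw [sub_eq_iff_eq_add] at hS
  set K := cubeSubst (levelSix * cubeSubst (genSeries 2))
  rw [residueEightyOne, hS, uSix_eq]
  set r := uEighteen
  have h : ∃ q, -(4 * r - 6 * r ^ 2 + 3 * r ^ 3) - (4 * r - 6 * r ^ 2 + 3 * r ^ 3) ^ 2 -
      (4 * r - 6 * r ^ 2 + 3 * r ^ 3) ^ 3 = -r - r ^ 2 - r ^ 3 + 3 * q :=
    ⟨-r - 3 * r ^ 2 - 6 * r ^ 3 + 76 * r ^ 4 - 180 * r ^ 5 + 213 * r ^ 6 - 144 * r ^ 7 +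
      54 * r ^ 8 - 9 * r ^ 9, by ring⟩
  obtain ⟨q, hq⟩ := h
  rw [hq]
  refine ⟨243 * S * (-r - r ^ 2 - r ^ 3 + 3 * q) + K * r ^ 5 * invFactor r * q +
    K * (-106 * r ^ 6 - 15 * r ^ 7 - 99 * r ^ 8 - 2 * r ^ 9 - 147 * r ^ 10 - 144 * r ^ 11 -
      135 * r ^ 12 - 81 * r ^ 13), ?_⟩
  unfold invFactor
  ring

/-- Since r³ ≡ u(q³) modulo 3, r⁶ + r⁷ + r⁸ ≡ u(q³)² (1 + r + r²), and section 1 of 1 + r + r² is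
-3xu². -/
theorem dvd_sectionThree_one_residueEightyOne :
    (3 : ℤ⟦X⟧) ∣ sectionThree 1 residueEightyOne := by
  have h := ofNat_dvd_sectionThree_sub_mul (i := 1) (p := 0) (by norm_num)
    residueEightyOne_sub_dvd ?_
  · rwa [mul_zero, sub_zero] at h
  · refine ⟨levelSix * (-5 * uSix ^ 3 + 39 * uSix ^ 4 - 243 * uSix ^ 5 + 945 * uSix ^ 6 -
      1458 * uSix ^ 7 + 729 * uSix ^ 8), ?_⟩
    obtain ⟨h0, h1, h2⟩ := sectionThree_one_uEighteen_pow
    simp only [map_sub, map_neg, h0, h1,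
      h2, sectionThree_uEighteen_pow_add_three (show 1 < 3 by norm_num), Nat.reduceAdd]
    ring

/-! ### The congruences -/

theorem coeff_of_ofNat_dvd {k : ℕ} [k.AtLeastTwo] {F : ℤ⟦X⟧}
    (h : (OfNat.ofNat k : ℤ⟦X⟧) ∣ F) (n : ℕ) : (OfNat.ofNat k : ℤ) ∣ coeff n F := by
  obtain ⟨S, rfl⟩ := h
  rw [← map_ofNat (C (R := ℤ)), coeff_C_mul]
  exact dvd_mul_right _ _

theorem coeff_ofNat_mul (k : ℕ) [k.AtLeastTwo] (F : ℤ⟦X⟧) (n : ℕ) :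
    coeff n (OfNat.ofNat k * F) = OfNat.ofNat k * coeff n F := by
  rw [← map_ofNat (C (R := ℤ)), coeff_C_mul]

theorem d_two_nine_mul_add_eight (n : ℕ) :
    (729 : ℤ) ∣ d 2 (9 * n + 8) - 27 * coeff (n + 1) residueNine := by
  have h := coeff_of_ofNat_dvd dvd_sectionThree_zero_sub_residueNine (n + 1)
  -- The factor X shifts indices by one: coefficient n + 1 here is `d 2` at 9(n + 1) - 1.
  rw [map_sub, coeff_ofNat_mul, coeff_sectionThree, show 3 * (n + 1) + 0 = (3 * n + 2) + 1 by ring,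
    coeff_succ_X_mul, coeff_sectionThree, show 3 * (3 * n + 2) + 2 = 9 * n + 8 by ring] at h
  exact h

theorem coeff_residueNine (n : ℕ) :
    (27 : ℤ) ∣ coeff (9 * n + 8) residueNine - 9 * coeff (n + 1) residueEightyOne := by
  have h := coeff_of_ofNat_dvd dvd_sectionThree_zero_sub_residueEightyOne (n + 1)
  rw [map_sub, coeff_ofNat_mul, coeff_sectionThree, show 3 * (n + 1) + 0 = (3 * n + 2) + 1 by ring,
    coeff_succ_X_mul, coeff_sectionThree, show 3 * (3 * n + 2) + 2 = 9 * n + 8 by ring] at h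
  exact h

theorem dvd_d_two_eightyOne_mul_add_fortyFour (n : ℕ) : (81 : ℤ) ∣ d 2 (81 * n + 44) := by
  have h := coeff_of_ofNat_dvd dvd_sectionThree_two_X_mul_residueNine n
  rw [coeff_sectionThree, coeff_succ_X_mul, coeff_sectionThree] at h
  have h1 := d_two_nine_mul_add_eight (9 * n + 4)
  rw [show 9 * (9 * n + 4) + 8 = 81 * n + 44 by ring] at h1
  rw [show 3 * (3 * n + 1) + 2 = 9 * n + 4 + 1 by ring] at h
  omega

theorem dvd_d_two_twentySeven_mul_add_eight (n : ℕ) : (243 : ℤ) ∣ d 2 (27 * n + 8) := by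
  have h := coeff_of_ofNat_dvd dvd_sectionThree_one_residueNine n
  rw [coeff_sectionThree] at h
  have h1 := d_two_nine_mul_add_eight (3 * n)
  rw [show 9 * (3 * n) + 8 = 27 * n + 8 by ring] at h1
  omega

theorem d_two_eightyOne_mul_add_seventyOne (n : ℕ) :
    (729 : ℤ) ∣ d 2 (81 * n + 71) - 243 * coeff (n + 1) residueEightyOne := by
  have h := coeff_residueNine n
  rw [show 9 * n + 8 = 9 * n + 7 + 1 by ring] at h
  have h1 := d_two_nine_mul_add_eight (9 * n + 7)
  rw [show 9 * (9 * n + 7) + 8 = 81 * n + 71 by ring] at h1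
  omega

theorem dvd_d_two_mul_add_seventyOne (n : ℕ) : (729 : ℤ) ∣ d 2 (243 * n + 71) := by
  have h := coeff_of_ofNat_dvd dvd_sectionThree_one_residueEightyOne n
  rw [coeff_sectionThree] at h
  have h1 := d_two_eightyOne_mul_add_seventyOne (3 * n)
  rw [show 81 * (3 * n) + 71 = 243 * n + 71 by ring] at h1
  omega

end ElongatedDiamonds

end

theorem mainTheorem1 :
    (∀ n : ℕ, ElongatedDiamonds.d 2 (81 * n + 44) ≡ 0 [ZMOD 81]) ∧
    (∀ j ∈ ({8, 35, 62, 71} : Set ℕ), ∀ n : ℕ,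
      ElongatedDiamonds.d 2 (81 * n + j) ≡ 0 [ZMOD 243]) ∧
    (∀ n : ℕ, ElongatedDiamonds.d 2 (243 * n + 71) ≡ 0 [ZMOD 729]) := by
  simp only [Int.modEq_zero_iff_dvd]
  refine ⟨ElongatedDiamonds.dvd_d_two_eightyOne_mul_add_fortyFour, ?_,
    ElongatedDiamonds.dvd_d_two_mul_add_seventyOne⟩
  rintro j (rfl | rfl | rfl | rfl) n
  · have h := ElongatedDiamonds.dvd_d_two_twentySeven_mul_add_eight (3 * n)
    rwa [show 27 * (3 * n) + 8 = 81 * n + 8 by ring] at h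
  · have h := ElongatedDiamonds.dvd_d_two_twentySeven_mul_add_eight (3 * n + 1)
    rwa [show 27 * (3 * n + 1) + 8 = 81 * n + 35 by ring] at h
  · have h := ElongatedDiamonds.dvd_d_two_twentySeven_mul_add_eight (3 * n + 2)
    rwa [show 27 * (3 * n + 2) + 8 = 81 * n + 62 by ring] at h
  -- Unlike 8, 35 and 62, the residue 71 is not 8 modulo 27; its factor 243 = 27 · 9 comes from the
  -- second iteration.
  · have h := ElongatedDiamonds.d_two_eightyOne_mul_add_seventyOne n
    omega
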